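/- Let $(\mathcal X,d)$ be a Polish space with a compatible metric $d$, equipped with its Borel $\sigma$-algebra, let $\lambda>0$, and for probability measures $\mu,\nu$ on $\mathcal X$ let $$W^{(\lambda)}(\mu,\nu)=\inf_{\pi\in\Pi(\mu,\nu)}\int_{\mathcal X\times\mathcal X}\min\{d(x,y),2\lambda\}\,d\pi(x,y),$$ where $\Pi(\mu,\nu)$ is the set of couplings of $\mu$ and $\nu$. Let $(\Theta,\rho_\Theta)$ be a non-empty metric space whose closed bounded subsets are compact (for example a non-empty closed subset of $\mathbb R^{d_\theta}$ with the Euclidean distance). For every $\theta\in\Theta$ let $\mu_\theta$ be a probability measure on $\mathcal X$ and, for $m\ge 1$, let $\mu_\theta^{(m)}$ be a probability measure on $\mathcal X^m$ (the law of a sample $Z_{1:m}=(Z_1,\dots,Z_m)$ from the model) under which every $Z_i$ has law $\mu_\theta$. Put $\hat\mu_{\theta,m}=m^{-1}\sum_{i=1}^m\delta_{Z_i}$ with $Z_{1:m}\sim\mu_\theta^{(m)}$, and let $\mathrm E_m$ denote the expectation over $\mu_\theta^{(m)}$. Fix $n\ge1$ and data $x_1,\dots,x_n\in\mathcal X$,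 and let $\hat\mu_n=n^{-1}\sum_{i=1}^n\delta_{x_i}$. Assume: (2) if $\rho_\Theta(\theta_k,\theta)\to0$, then $\mu_{\theta_k}\to\mu_\theta$ weakly; (4) for every $m\ge1$, if $\rho_\Theta(\theta_k,\theta)\to0$ as $k\to\infty$, then $\mu^{(m)}_{\theta_k}\to\mu^{(m)}_\theta$ weakly; (5) if $\rho_\Theta(\theta_k,\theta)\to0$, then $\mathrm E_k\,W^{(\lambda)}(\mu_{\theta_k},\hat\mu_{\theta_k,k})\to0$ as $k\to\infty$; (6) for some $\varepsilon>0$ the set $\{\theta\in\Theta: W^{(\lambda)}(\hat\mu_n,\mu_\theta)\le\inf_{\theta'\in\Theta}W^{(\lambda)}(\hat\mu_n,\mu_{\theta'})+\varepsilon\}$ is bounded. Then, as $m\to\infty$, $$\inf_{\theta\in\Theta}\mathrm E_m\bigl[W^{(\lambda)}(\hat\mu_n,\hat\mu_{\theta,m})\bigr]\longrightarrow\inf_{\theta\in\Theta}W^{(\lambda)}(\hat\mu_n,\mu_\theta),$$ and there is an $\tilde m$ such that for all $m\ge\tilde m$ the sets $A_m=\operatorname{argmin}_{\theta\in\Theta}\mathrm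 E_m[W^{(\lambda)}(\hat\mu_n,\hat\mu_{\theta,m})]$ are non-empty, the union $\bigcup_{m\ge\tilde m}A_m$ is bounded, and $$\limsup_{m\to\infty}A_m\subset\operatorname{argmin}_{\theta\in\Theta}W^{(\lambda)}(\hat\mu_n,\mu_\theta),$$ where $\limsup_m A_m$ is the set of all limits of sequences $(\theta_k)$ with $\theta_k\in A_{m_k}$ for some $m_1<m_2<\cdots$. -/

import Mathlib

open Filter Topology MeasureTheory
open scoped ENNReal

noncomputable section

/-- The trimmed cost `c_lam (x, y) = min (d (x, y)) (2 lam)`. -/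
def trimmedCost {X : Type*} [MetricSpace X] (lam : ℝ) (x y : X) : ℝ :=
  min (dist x y) (2 * lam)

/-- The set of all couplings of `μ` and `ν`. -/
def couplings {X : Type*} [MeasurableSpace X] (μ ν : Measure X) : Set (Measure (X × X)) :=
  {π | π.fst = μ ∧ π.snd = ν}

/-- The robust Wasserstein distance: the infimum over all couplings of the expected trimmed cost.
For probability measures the set of values is non-empty and contained in `[0, 2 lam]`. -/
def robustW {X : Type*} [MetricSpace X] [MeasurableSpace X] (lam : ℝ) (μ ν : Measure X) : ℝ :=
  sInf ((fun π : Measure (X × X) => ∫ p, trimmedCost lam p.1 p.2 ∂π) '' couplings μ ν)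

/-- The empirical measure `k⁻¹ ∑ i, δ_{z i}` of a sample `z` of size `k ≥ 1`. -/
def empiricalMeasure {X : Type*} [MeasurableSpace X] {k : ℕ} (z : Fin k → X) : Measure X :=
  (k : ℝ≥0∞)⁻¹ • ∑ i, Measure.dirac (z i)

/-- The expectation `E_m W (ν, μ̂_m)`, where `μ̂_m` is the empirical measure of a sample of
size `m` with joint law `P`. -/
def expectedRobustW {X : Type*} [MetricSpace X] [MeasurableSpace X] (lam : ℝ)
    (ν : Measure X) {m : ℕ} (P : Measure (Fin m → X)) : ℝ :=
  ∫ z, robustW lam ν (empiricalMeasure z) ∂P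

/-- The set of global minimizers of `f`. -/
def argminSet {T : Type*} (f : T → ℝ) : Set T := {θ | ∀ θ', f θ ≤ f θ'}

/-- The outer limit (in the sense of Painlevé and Kuratowski) of a sequence of sets: all limits
of sequences of points taken from the sets along a subsequence. -/
def outerLimit {T : Type*} [TopologicalSpace T] (S : ℕ → Set T) : Set T :=
  {θ | ∃ (φ : ℕ → ℕ) (t : ℕ → T), StrictMono φ ∧ (∀ k, t k ∈ S (φ k)) ∧ Tendsto t atTop (𝓝 θ)}

end

/-! Let `F m θ` be the expected distance from the data to a sample of size `m`, and `f θ` the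
distance to the model. Two inequalities carry the proof.

By the triangle inequality, `|F m - f|` is at most the expected distance from the model to its own
empirical measure (`abs_expectedRobustW_sub_le`). So `h5` gives continuous, hence locally uniform,
convergence; as `h4` makes each `F m` with `m ≥ 1` continuous, `f` is continuous.

By convexity of the distance, and since the empirical measure has mean `μ θ`, also `f ≤ F m`
(`robustW_le_expectedRobustW`). This replaces uniform control at infinity: outside the compact set
of near-minimizers of `f`, `F m` stays above a level that it eventually undercuts at a minimizer of
`f`. -/

/-! ### Continuous convergence and stability of minimizers -/

section Optimization

variable {T : Type*} [MetricSpace T]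

/-- Continuous convergence `g k (t k) → 0` along every convergent sequence of parameters is
joint convergence in the index and the parameter. -/
lemma tendsto_atTop_prod_nhds_of_seq {g : ℕ → T → ℝ}
    (hg : ∀ (t : ℕ → T) (θ : T), Tendsto t atTop (𝓝 θ) →
      Tendsto (fun k => g k (t k)) atTop (𝓝 0)) (θ : T) :
    Tendsto (fun p : ℕ × T => g p.1 p.2) (atTop ×ˢ 𝓝 θ) (𝓝 0) := by
  refine tendsto_of_seq_tendsto fun u hu => ?_
  refine tendsto_of_subseq_tendsto fun ns hns => ?_
  have h1 : Tendsto (fun k => (u (ns k)).1) atTop atTop :=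
    (tendsto_fst.comp hu).comp hns
  have h2 : Tendsto (fun k => (u (ns k)).2) atTop (𝓝 θ) :=
    (tendsto_snd.comp hu).comp hns
  obtain ⟨φ, hφ, hmono⟩ := strictMono_subseq_of_tendsto_atTop h1
  refine ⟨φ, ?_⟩
  set m : ℕ → ℕ := fun k => (u (ns (φ k))).1 with hm
  have hmono' : StrictMono m := hmono
  -- The hypothesis needs a parameter at every index: the pairs sit at the strictly increasing
  -- indices `m k`, and the limit `θ` fills the gaps.
  set t : ℕ → T := Function.extend m (fun k => (u (ns (φ k))).2) (fun _ => θ) with ht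
  have htm : ∀ k, t (m k) = (u (ns (φ k))).2 := fun k => hmono'.injective.extend_apply _ _ _
  have htθ : Tendsto t atTop (𝓝 θ) := by
    rw [tendsto_def]
    intro s hs
    have hev := (h2.comp hφ.tendsto_atTop).eventually hs
    obtain ⟨N, hN⟩ := eventually_atTop.1 hev
    refine mem_atTop_sets.2 ⟨m N, fun j hj => ?_⟩
    by_cases hj' : ∃ k, m k = j
    · obtain ⟨k, rfl⟩ := hj'
      have : t (m k) ∈ s := by
        rw [htm]
        exact hN k (hmono'.le_iff_le.1 hj)
      exact this
    · have : t j = θ := Function.extend_apply' _ _ _ hj'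
      simpa [this] using mem_of_mem_nhds hs
  refine ((hg t θ htθ).comp hmono'.tendsto_atTop).congr fun k => ?_
  exact congrArg (g (m k)) (htm k)

/-- If continuous functions `F m` converge continuously to `f`, then `f` is continuous. -/
lemma continuous_of_seq_tendsto {F : ℕ → T → ℝ} {f : T → ℝ}
    (hF : ∀ m, 1 ≤ m → Continuous (F m))
    (hFf : ∀ (t : ℕ → T) (θ : T), Tendsto t atTop (𝓝 θ) →
      Tendsto (fun k => F k (t k) - f (t k)) atTop (𝓝 0)) : Continuous f := by
  refine TendstoLocallyUniformly.continuous (F := F) (p := atTop) ?_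
    ((eventually_ge_atTop 1).mono hF).frequently
  rw [tendstoLocallyUniformly_iff_forall_tendsto]
  intro θ
  rw [tendsto_uniformity_iff_dist_tendsto_zero]
  have h := tendsto_atTop_prod_nhds_of_seq (g := fun k t => F k t - f t) hFf θ
  simpa [Real.dist_eq, abs_sub_comm] using h.abs

/-- Convergence of minima and minimizers for functions `F m` that converge continuously to `f`
from above, when some set of near-minimizers of `f` is bounded. -/
theorem tendsto_iInf_and_outerLimit_argminSet [ProperSpace T] [Nonempty T]
    {F : ℕ → T → ℝ} {f : T → ℝ} (hbdd : BddBelow (Set.range f))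
    (hF : ∀ m, 1 ≤ m → Continuous (F m)) (hle : ∀ m, 1 ≤ m → ∀ θ, f θ ≤ F m θ)
    (hFf : ∀ (t : ℕ → T) (θ : T), Tendsto t atTop (𝓝 θ) →
      Tendsto (fun k => F k (t k) - f (t k)) atTop (𝓝 0))
    (hnear : ∃ ε : ℝ, 0 < ε ∧ Bornology.IsBounded {θ | f θ ≤ (⨅ θ', f θ') + ε}) :
    Tendsto (fun m => ⨅ θ, F m θ) atTop (𝓝 (⨅ θ, f θ)) ∧
    (∃ m₀ : ℕ, (∀ m, m₀ ≤ m → (argminSet (F m)).Nonempty) ∧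
      Bornology.IsBounded (⋃ m : ℕ, ⋃ _ : m₀ ≤ m, argminSet (F m))) ∧
    outerLimit (fun m => argminSet (F m)) ⊆ argminSet f := by
  obtain ⟨ε, hε, hB⟩ := hnear
  have hf : Continuous f := continuous_of_seq_tendsto hF hFf
  set I := ⨅ θ, f θ with hI
  have hIle : ∀ θ, I ≤ f θ := fun θ => ciInf_le hbdd θ
  set K : Set T := {θ | f θ ≤ I + ε} with hK
  have hKc : IsCompact K :=
    Metric.isCompact_of_isClosed_isBounded (isClosed_le hf continuous_const) hB
  obtain ⟨θ₁, hθ₁⟩ : ∃ θ, f θ < I + ε := exists_lt_of_ciInf_lt (lt_add_of_pos_right _ hε)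
  obtain ⟨θ₀, hθ₀K, hθ₀⟩ := hKc.exists_isMinOn ⟨θ₁, hθ₁.le⟩ hf.continuousOn
  have hfθ₀ : f θ₀ = I := by
    refine le_antisymm (le_ciInf fun θ => ?_) (hIle θ₀)
    by_cases hθ : θ ∈ K
    · exact hθ₀ hθ
    · exact le_trans hθ₀K (not_le.1 hθ).le
  have hlim : Tendsto (fun m => F m θ₀) atTop (𝓝 I) := by
    have := (hFf (fun _ => θ₀) θ₀ tendsto_const_nhds).add_const (f θ₀)
    simpa [hfθ₀] using this
  have hbddF : ∀ m, 1 ≤ m → BddBelow (Set.range (F m)) := fun m hm =>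
    ⟨I, by rintro _ ⟨θ, rfl⟩; exact (hIle θ).trans (hle m hm θ)⟩
  obtain ⟨m₁, hm₁⟩ := eventually_atTop.1
    (hlim.eventually_lt_const (lt_add_of_pos_right I hε))
  -- The chain is `F m θ₀ < I + ε < f θ ≤ F m θ`.
  have houtside : ∀ m, max 1 m₁ ≤ m → ∀ θ, θ ∉ K → F m θ₀ < F m θ := fun m hm θ hθ =>
    (hm₁ m ((le_max_right _ _).trans hm)).trans
      ((not_le.1 hθ).trans_le (hle m ((le_max_left _ _).trans hm) θ))
  refine ⟨?_, ⟨max 1 m₁, fun m hm => ?_, hB.subset ?_⟩, ?_⟩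
  · refine tendsto_of_tendsto_of_tendsto_of_le_of_le' tendsto_const_nhds hlim ?_ ?_
    · filter_upwards [eventually_ge_atTop 1] with m hm
      exact le_ciInf fun θ => (hIle θ).trans (hle m hm θ)
    · filter_upwards [eventually_ge_atTop 1] with m hm
      exact ciInf_le (hbddF m hm) θ₀
  · obtain ⟨θ, -, hθ⟩ := hKc.exists_isMinOn ⟨θ₀, hθ₀K⟩
      (hF m ((le_max_left _ _).trans hm)).continuousOn
    refine ⟨θ, fun θ' => ?_⟩
    by_cases hθ' : θ' ∈ K
    · exact hθ hθ'
    · exact (hθ hθ₀K).trans (houtside m hm θ' hθ').le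
  · intro θ hθ
    simp only [Set.mem_iUnion] at hθ
    obtain ⟨m, hm, hθ⟩ := hθ
    by_contra hθK
    exact absurd (hθ θ₀) (not_le.2 (houtside m hm θ hθK))
  · rintro θ ⟨φ, t, hφ, ht, htθ⟩ θ'
    -- Pass to the limit in `f (t k) ≤ F (φ k) (t k) ≤ F (φ k) θ₀`, whose right side tends to `I`.
    have h1 : f θ ≤ I := by
      refine le_of_tendsto_of_tendsto ((hf.tendsto θ).comp htθ) (hlim.comp hφ.tendsto_atTop) ?_
      filter_upwards [hφ.tendsto_atTop.eventually_ge_atTop 1] with k hk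
      exact (hle _ hk _).trans (ht k θ₀)
    exact h1.trans (hIle θ')

end Optimization

/-! ### Couplings and the robust Wasserstein distance -/

lemma isProbabilityMeasure_of_mem_couplings {Y : Type*} [MeasurableSpace Y] {μ ν : Measure Y} [IsProbabilityMeasure μ]
    {π : Measure (Y × Y)} (hπ : π ∈ couplings μ ν) : IsProbabilityMeasure π :=
  ⟨by rw [← Measure.fst_univ, hπ.1, measure_univ]⟩

lemma couplings_nonempty {Y : Type*} [MeasurableSpace Y] (μ ν : Measure Y) [IsProbabilityMeasure μ] [IsProbabilityMeasure ν] :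
    (couplings μ ν).Nonempty :=
  ⟨μ.prod ν, Measure.fst_prod, Measure.snd_prod⟩

section RobustWasserstein

open ProbabilityTheory

variable {X : Type*} [MetricSpace X]

lemma trimmedCost_nonneg {lam : ℝ} (hlam : 0 ≤ lam) (x y : X) : 0 ≤ trimmedCost lam x y :=
  le_min dist_nonneg (by positivity)

lemma trimmedCost_le (lam : ℝ) (x y : X) : trimmedCost lam x y ≤ 2 * lam := min_le_right _ _

lemma trimmedCost_le_dist (lam : ℝ) (x y : X) : trimmedCost lam x y ≤ dist x y := min_le_left _ _

lemma trimmedCost_comm (lam : ℝ) (x y : X) : trimmedCost lam x y = trimmedCost lam y x := by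
  simp [trimmedCost, dist_comm]

/-- If either cost on the right is truncated, the right side is already at least `2 * lam`. -/
lemma trimmedCost_triangle {lam : ℝ} (hlam : 0 ≤ lam) (x y z : X) :
    trimmedCost lam x z ≤ trimmedCost lam x y + trimmedCost lam y z := by
  have h := dist_triangle x y z
  have h1 := dist_nonneg (x := x) (y := y)
  have h2 := dist_nonneg (x := y) (y := z)
  simp only [trimmedCost]
  rcases min_choice (dist x y) (2 * lam) with h3 | h3 <;>
  rcases min_choice (dist y z) (2 * lam) with h4 | h4 <;>
  rw [h3, h4]
  · exact (min_le_left _ _).trans h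
  · exact (min_le_right _ _).trans (by linarith)
  · exact (min_le_right _ _).trans (by linarith)
  · exact (min_le_right _ _).trans (by linarith)

lemma continuous_trimmedCost (lam : ℝ) : Continuous fun p : X × X => trimmedCost lam p.1 p.2 :=
  continuous_dist.min continuous_const

variable [MeasurableSpace X]

lemma robustW_nonneg {lam : ℝ} (hlam : 0 ≤ lam) (μ ν : Measure X) : 0 ≤ robustW lam μ ν := by
  refine Real.sInf_nonneg ?_
  rintro _ ⟨π, -, rfl⟩
  exact integral_nonneg fun p => trimmedCost_nonneg hlam _ _

lemma robustW_le_integral {lam : ℝ} (hlam : 0 ≤ lam) {μ ν : Measure X} {π : Measure (X × X)}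
    (hπ : π ∈ couplings μ ν) : robustW lam μ ν ≤ ∫ p, trimmedCost lam p.1 p.2 ∂π := by
  refine csInf_le ⟨0, ?_⟩ ⟨π, hπ, rfl⟩
  rintro _ ⟨π, -, rfl⟩
  exact integral_nonneg fun p => trimmedCost_nonneg hlam _ _

/-- Near-optimal couplings suffice throughout, so attainment of the infimum is never needed. -/
lemma exists_coupling_integral_lt (lam : ℝ) (μ ν : Measure X) [IsProbabilityMeasure μ]
    [IsProbabilityMeasure ν] {ε : ℝ} (hε : 0 < ε) :
    ∃ π ∈ couplings μ ν, ∫ p, trimmedCost lam p.1 p.2 ∂π < robustW lam μ ν + ε := by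
  obtain ⟨_, ⟨π, hπ, rfl⟩, h⟩ := Real.lt_sInf_add_pos
    ((couplings_nonempty μ ν).image fun π : Measure (X × X) =>
      ∫ p, trimmedCost lam p.1 p.2 ∂π) hε
  exact ⟨π, hπ, h⟩

section Borel

variable [SecondCountableTopology X] [BorelSpace X]

lemma integrable_trimmedCost {lam : ℝ} (hlam : 0 ≤ lam) (π : Measure (X × X))
    [IsFiniteMeasure π] : Integrable (fun p => trimmedCost lam p.1 p.2) π :=
  Integrable.of_bound (continuous_trimmedCost lam).measurable.aestronglyMeasurable (2 * lam)
    (ae_of_all _ fun p => by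
      rw [Real.norm_of_nonneg (trimmedCost_nonneg hlam _ _)]
      exact trimmedCost_le _ _ _)

lemma robustW_le_two_mul {lam : ℝ} (hlam : 0 ≤ lam) (μ ν : Measure X) [IsProbabilityMeasure μ]
    [IsProbabilityMeasure ν] : robustW lam μ ν ≤ 2 * lam := by
  obtain ⟨π, hπ⟩ := couplings_nonempty μ ν
  have := isProbabilityMeasure_of_mem_couplings hπ
  refine (robustW_le_integral hlam hπ).trans ?_
  refine (integral_mono (integrable_trimmedCost hlam π) (integrable_const (2 * lam))
    fun p => trimmedCost_le _ _ _).trans (by simp)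

lemma robustW_le_symm {lam : ℝ} (hlam : 0 ≤ lam) (μ ν : Measure X) [IsProbabilityMeasure μ]
    [IsProbabilityMeasure ν] : robustW lam μ ν ≤ robustW lam ν μ := by
  refine le_of_forall_pos_lt_add fun ε hε => ?_
  obtain ⟨π, hπ, h⟩ := exists_coupling_integral_lt lam ν μ hε
  refine lt_of_le_of_lt (robustW_le_integral hlam (π := π.map Prod.swap)
    ⟨by rw [Measure.fst_map_swap, hπ.2], by rw [Measure.snd_map_swap, hπ.1]⟩) ?_
  rw [integral_map measurable_swap.aemeasurable
    (continuous_trimmedCost lam).measurable.aestronglyMeasurable]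
  simpa only [Prod.fst_swap, Prod.snd_swap, trimmedCost_comm lam] using h

lemma robustW_comm {lam : ℝ} (hlam : 0 ≤ lam) (μ ν : Measure X) [IsProbabilityMeasure μ]
    [IsProbabilityMeasure ν] : robustW lam μ ν = robustW lam ν μ :=
  le_antisymm (robustW_le_symm hlam μ ν) (robustW_le_symm hlam ν μ)

lemma integral_kernel_comp {α β : Type*} [MeasurableSpace α] [MeasurableSpace β]
    (P : Measure α) [SFinite P] (κ : Kernel α β) [IsSFiniteKernel κ] {f : β → ℝ}
    (hf : Integrable f (κ ∘ₘ P)) : ∫ y, f y ∂(κ ∘ₘ P) = ∫ a, ∫ y, f y ∂κ a ∂P := by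
  have hf' : Integrable (fun p : α × β => f p.2) (P ⊗ₘ κ) :=
    (Measure.integrable_compProd_snd_iff hf.1).2 hf
  rw [← Measure.integral_compProd hf']
  rw [← Measure.snd_compProd] at hf ⊢
  exact integral_map measurable_snd.aemeasurable hf.1

/-- A mixture of couplings couples the mixtures of the marginals. -/
lemma robustW_kernel_comp_le {lam : ℝ} (hlam : 0 ≤ lam) {Ω : Type*} [MeasurableSpace Ω]
    (P : Measure Ω) [IsProbabilityMeasure P] (κ : Kernel Ω (X × X)) [IsMarkovKernel κ] :
    robustW lam (κ.fst ∘ₘ P) (κ.snd ∘ₘ P) ≤ ∫ z, ∫ p, trimmedCost lam p.1 p.2 ∂κ z ∂P := by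
  rw [← integral_kernel_comp P κ (integrable_trimmedCost hlam _)]
  refine robustW_le_integral hlam ⟨?_, ?_⟩
  · rw [Measure.fst, Measure.map_comp _ _ measurable_fst, Kernel.fst_eq]
  · rw [Measure.snd, Measure.map_comp _ _ measurable_snd, Kernel.snd_eq]

end Borel

section Polish

variable [PolishSpace X] [BorelSpace X]

/-- The triangle inequality, by gluing couplings along their common marginal. -/
lemma robustW_triangle {lam : ℝ} (hlam : 0 ≤ lam) (μ ν ρ : Measure X) [IsProbabilityMeasure μ]
    [IsProbabilityMeasure ν] [IsProbabilityMeasure ρ] :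
    robustW lam μ ρ ≤ robustW lam μ ν + robustW lam ν ρ := by
  refine le_of_forall_pos_lt_add fun ε hε => ?_
  obtain ⟨π₁, hπ₁, h₁⟩ := exists_coupling_integral_lt lam μ ν (half_pos hε)
  obtain ⟨π₂, hπ₂, h₂⟩ := exists_coupling_integral_lt lam ν ρ (half_pos hε)
  have := isProbabilityMeasure_of_mem_couplings hπ₁
  have := isProbabilityMeasure_of_mem_couplings hπ₂
  have : Nonempty X := nonempty_of_isProbabilityMeasure μ
  -- Given `(x, y)` drawn from `π₁`, the third point follows the conditional law of `π₂` given `y`,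
  -- so it depends on `y` alone.
  set κ : Kernel (X × X) X := π₂.condKernel.comap Prod.snd measurable_snd with hκ
  set γ : Measure ((X × X) × X) := π₁ ⊗ₘ κ with hγ
  have hγ₁ : γ.map Prod.fst = π₁ := Measure.fst_compProd π₁ κ
  have hm₂ : Measurable fun q : (X × X) × X => (q.1.2, q.2) := by fun_prop
  have hm₃ : Measurable fun q : (X × X) × X => (q.1.1, q.2) := by fun_prop
  have hγ₂ : γ.map (fun q => (q.1.2, q.2)) = π₂ := by
    refine Measure.ext_of_lintegral _ fun f hf => ?_
    conv_rhs => rw [← π₂.disintegrate π₂.condKernel, Measure.lintegral_compProd hf, hπ₂.1, ← hπ₁.2,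
      Measure.snd, lintegral_map (hf.lintegral_kernel_prod_right') measurable_snd]
    rw [lintegral_map hf hm₂, hγ, Measure.lintegral_compProd (f := fun q : (X × X) × X => f (q.1.2, q.2)) (hf.comp hm₂)]
    simp [hκ]
  have hγ₃ : γ.map (fun q => (q.1.1, q.2)) ∈ couplings μ ρ := by
    constructor
    · rw [← hπ₁.1, ← hγ₁, Measure.fst, Measure.fst, Measure.map_map measurable_fst hm₃,
        Measure.map_map measurable_fst measurable_fst]
      rfl
    · rw [← hπ₂.2, ← hγ₂, Measure.snd, Measure.snd, Measure.map_map measurable_snd hm₃,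
        Measure.map_map measurable_snd hm₂]
      rfl
  have hmeas : ∀ π : Measure (X × X),
      AEStronglyMeasurable (fun p => trimmedCost lam p.1 p.2) π := fun π =>
    (continuous_trimmedCost lam).measurable.aestronglyMeasurable
  have hint₁ : Integrable (fun q : (X × X) × X => trimmedCost lam q.1.1 q.1.2) γ :=
    (integrable_trimmedCost hlam (γ.map Prod.fst)).comp_measurable measurable_fst
  have hint₂ : Integrable (fun q : (X × X) × X => trimmedCost lam q.1.2 q.2) γ :=
    (integrable_trimmedCost hlam (γ.map fun q : (X × X) × X => (q.1.2, q.2))).comp_measurable hm₂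
  have hint₃ : Integrable (fun q : (X × X) × X => trimmedCost lam q.1.1 q.2) γ :=
    (integrable_trimmedCost hlam (γ.map fun q : (X × X) × X => (q.1.1, q.2))).comp_measurable hm₃
  have key : ∫ p, trimmedCost lam p.1 p.2 ∂(γ.map fun q => (q.1.1, q.2)) ≤
      ∫ p, trimmedCost lam p.1 p.2 ∂π₁ + ∫ p, trimmedCost lam p.1 p.2 ∂π₂ := by
    conv_rhs => rw [← hγ₂]; rw [← hγ₁]
    rw [integral_map hm₃.aemeasurable (hmeas _), integral_map hm₂.aemeasurable (hmeas _),
      integral_map measurable_fst.aemeasurable (hmeas _), ← integral_add hint₁ hint₂]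
    exact integral_mono hint₃ (hint₁.add hint₂) fun q => trimmedCost_triangle hlam _ _ _
  linarith [robustW_le_integral hlam hγ₃]

end Polish

end RobustWasserstein

/-! ### Empirical measures and their means -/

section Empirical

open ProbabilityTheory

lemma isProbabilityMeasure_empiricalMeasure {Y : Type*} [MeasurableSpace Y] {m : ℕ} (hm : 1 ≤ m)
    (z : Fin m → Y) : IsProbabilityMeasure (empiricalMeasure z) := by
  refine ⟨?_⟩
  simp only [empiricalMeasure, Measure.smul_apply, Measure.finsetSum_apply, measure_univ,
    Finset.sum_const, Finset.card_univ, Fintype.card_fin, smul_eq_mul, nsmul_eq_mul, mul_one]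
  exact ENNReal.inv_mul_cancel (by simp; omega) (by simp)

lemma map_empiricalMeasure {Y Z : Type*} [MeasurableSpace Y] [MeasurableSpace Z] {m : ℕ}
    (z : Fin m → Y) {g : Y → Z} (hg : Measurable g) :
    (empiricalMeasure z).map g = empiricalMeasure fun i => g (z i) := by
  ext s hs
  simp [empiricalMeasure, Measure.map_apply hg hs, Measure.dirac_apply' _ hs,
    Measure.dirac_apply' _ (hg hs), Set.indicator]
  rfl

lemma measurable_empiricalMeasure {Y : Type*} [MeasurableSpace Y] (m : ℕ) :
    Measurable (empiricalMeasure : (Fin m → Y) → Measure Y) := by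
  refine Measure.measurable_of_measurable_coe _ fun s hs => ?_
  simp only [empiricalMeasure, Measure.smul_apply, Measure.finsetSum_apply, smul_eq_mul]
  refine Measurable.const_mul (Finset.measurable_sum _ fun i _ => ?_) _
  exact (Measure.measurable_coe hs).comp (Measure.measurable_dirac.comp (measurable_pi_apply i))

/-- The empirical measure of a sample, as a Markov kernel. -/
noncomputable def empiricalKernel (Y : Type*) [MeasurableSpace Y] (m : ℕ) : Kernel (Fin m → Y) Y :=
  ⟨empiricalMeasure, measurable_empiricalMeasure m⟩

/-- The mean of the empirical measure of an identically distributed sample. -/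
lemma empiricalKernel_comp {Y : Type*} [MeasurableSpace Y] {m : ℕ} (hm : 1 ≤ m)
    (P : Measure (Fin m → Y)) (μ : Measure Y) (hP : ∀ i, P.map (fun z => z i) = μ) :
    empiricalKernel Y m ∘ₘ P = μ := by
  ext s hs
  rw [Measure.bind_apply hs (Kernel.aemeasurable _)]
  simp only [empiricalKernel, Kernel.coe_mk, empiricalMeasure, Measure.smul_apply,
    Measure.finsetSum_apply, smul_eq_mul]
  have hmeas : ∀ i : Fin m, Measurable fun z : Fin m → Y => Measure.dirac (z i) s := fun i =>
    (Measure.measurable_coe hs).comp (Measure.measurable_dirac.comp (measurable_pi_apply i))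
  rw [lintegral_const_mul _ (Finset.measurable_sum _ fun i _ => hmeas i),
    lintegral_finsetSum _ fun i _ => hmeas i]
  have : ∀ i : Fin m, ∫⁻ z, Measure.dirac (z i) s ∂P = μ s := fun i => by
    rw [← hP i, Measure.map_apply (measurable_pi_apply i) hs,
      ← lintegral_indicator_one (measurable_pi_apply i hs)]
    refine lintegral_congr fun z => ?_
    rw [Measure.dirac_apply' _ hs]
    rfl
  simp only [this, Finset.sum_const, Finset.card_univ, Fintype.card_fin, nsmul_eq_mul]
  rw [← mul_assoc, ENNReal.inv_mul_cancel (by simp; omega) (by simp), one_mul]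

variable {X : Type*} [MetricSpace X] [MeasurableSpace X] [SecondCountableTopology X] [BorelSpace X]

lemma integral_trimmedCost_empiricalMeasure_le {lam : ℝ} (hlam : 0 ≤ lam) {m : ℕ} (hm : 1 ≤ m)
    (z z' : Fin m → X) :
    ∫ p, trimmedCost lam p.1 p.2 ∂(empiricalMeasure fun i => (z i, z' i)) ≤ dist z z' := by
  have hm' : (0 : ℝ) < m := by exact_mod_cast hm
  rw [empiricalMeasure, integral_smul_measure, integral_finsetSum_measure fun i _ =>
    integrable_trimmedCost hlam _]
  simp only [integral_dirac, ENNReal.toReal_inv, ENNReal.toReal_natCast, smul_eq_mul]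
  rw [inv_mul_le_iff₀ hm']
  refine (Finset.sum_le_card_nsmul _ _ (dist z z') fun i _ =>
    (trimmedCost_le_dist _ _ _).trans (dist_le_pi_dist z z' i)).trans ?_
  simp

/-- Pairing the `i`-th points of the two samples is a coupling, and the distance on `Fin m → X` is
the maximum over coordinates. -/
lemma robustW_empiricalMeasure_le_dist {lam : ℝ} (hlam : 0 ≤ lam) {m : ℕ} (hm : 1 ≤ m)
    (z z' : Fin m → X) : robustW lam (empiricalMeasure z) (empiricalMeasure z') ≤ dist z z' := by
  refine (robustW_le_integral hlam ⟨?_, ?_⟩).trans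
    (integral_trimmedCost_empiricalMeasure_le hlam hm z z')
  · exact map_empiricalMeasure _ measurable_fst
  · exact map_empiricalMeasure _ measurable_snd

end Empirical

/-! ### Expected distance to the empirical measure -/

section Expected

open ProbabilityTheory

variable {X : Type*} [MetricSpace X] [MeasurableSpace X] [PolishSpace X] [BorelSpace X]

lemma continuous_robustW_empiricalMeasure {lam : ℝ} (hlam : 0 ≤ lam) (ν : Measure X)
    [IsProbabilityMeasure ν] {m : ℕ} (hm : 1 ≤ m) :
    Continuous fun z : Fin m → X => robustW lam ν (empiricalMeasure z) := by
  refine LipschitzWith.continuous (K := 1) (LipschitzWith.of_le_add fun z z' => ?_)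
  have := isProbabilityMeasure_empiricalMeasure hm z
  have := isProbabilityMeasure_empiricalMeasure hm z'
  have h1 := robustW_triangle hlam ν (empiricalMeasure z') (empiricalMeasure z)
  have h2 := robustW_empiricalMeasure_le_dist hlam hm z' z
  rw [dist_comm] at h2
  linarith

lemma integrable_robustW_empiricalMeasure {lam : ℝ} (hlam : 0 ≤ lam) (ν : Measure X)
    [IsProbabilityMeasure ν] {m : ℕ} (hm : 1 ≤ m) (P : Measure (Fin m → X)) [IsFiniteMeasure P] :
    Integrable (fun z => robustW lam ν (empiricalMeasure z)) P := by
  refine Integrable.of_bound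
    (continuous_robustW_empiricalMeasure hlam ν hm).measurable.aestronglyMeasurable (2 * lam)
    (ae_of_all _ fun z => ?_)
  have := isProbabilityMeasure_empiricalMeasure hm z
  rw [Real.norm_of_nonneg (robustW_nonneg hlam _ _)]
  exact robustW_le_two_mul hlam _ _

/-- The expected robust distance to the empirical measure depends weakly continuously on the
law of the sample. -/
lemma continuous_expectedRobustW {lam : ℝ} (hlam : 0 ≤ lam) (ν : Measure X)
    [IsProbabilityMeasure ν] {m : ℕ} (hm : 1 ≤ m) :
    Continuous fun P : ProbabilityMeasure (Fin m → X) =>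
      expectedRobustW lam ν (P : Measure (Fin m → X)) := by
  let f : BoundedContinuousFunction (Fin m → X) ℝ := BoundedContinuousFunction.ofNormedAddCommGroup
    (fun z => robustW lam ν (empiricalMeasure z)) (continuous_robustW_empiricalMeasure hlam ν hm)
    (2 * lam) fun z => by
      have := isProbabilityMeasure_empiricalMeasure hm z
      rw [Real.norm_of_nonneg (robustW_nonneg hlam _ _)]
      exact robustW_le_two_mul hlam _ _
  refine continuous_iff_continuousAt.2 fun P => ?_
  exact ProbabilityMeasure.tendsto_iff_forall_integral_tendsto.1 tendsto_id f

lemma abs_expectedRobustW_sub_le {lam : ℝ} (hlam : 0 ≤ lam) (ν μ : Measure X)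
    [IsProbabilityMeasure ν] [IsProbabilityMeasure μ] {m : ℕ} (hm : 1 ≤ m)
    (P : Measure (Fin m → X)) [IsProbabilityMeasure P] :
    |expectedRobustW lam ν P - robustW lam ν μ| ≤ expectedRobustW lam μ P := by
  have hν := integrable_robustW_empiricalMeasure hlam ν hm P
  have hμ := integrable_robustW_empiricalMeasure hlam μ hm P
  have h : expectedRobustW lam ν P - robustW lam ν μ =
      ∫ z, (robustW lam ν (empiricalMeasure z) - robustW lam ν μ) ∂P := by
    rw [integral_sub hν (integrable_const _)]
    simp [expectedRobustW]
  rw [h]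
  refine (abs_integral_le_integral_abs).trans
    (integral_mono (hν.sub (integrable_const _)).abs hμ fun z => ?_)
  have := isProbabilityMeasure_empiricalMeasure hm z
  have h1 := robustW_triangle hlam ν μ (empiricalMeasure z)
  have h2 := robustW_triangle hlam ν (empiricalMeasure z) μ
  rw [robustW_comm hlam (empiricalMeasure z) μ] at h2
  exact abs_sub_le_iff.2 ⟨by linarith, by linarith⟩

/-- A measurable map with countably many values that is uniformly close to the identity. -/
lemma exists_measurable_nat_dist_lt (Y : Type*) [MetricSpace Y] [MeasurableSpace Y]
    [SecondCountableTopology Y] [OpensMeasurableSpace Y] [Nonempty Y] {ε : ℝ} (hε : 0 < ε) :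
    ∃ j : Y → ℕ, Measurable j ∧ ∀ y, dist y (TopologicalSpace.denseSeq Y (j y)) < ε := by
  classical
  have hex : ∀ y : Y, ∃ N, dist y (TopologicalSpace.denseSeq Y N) < ε := fun y =>
    (TopologicalSpace.denseRange_denseSeq Y).exists_dist_lt y hε
  exact ⟨fun y => Nat.find (hex y),
    measurable_find hex fun N => (measurableSet_ball (x := TopologicalSpace.denseSeq Y N)),
    fun y => Nat.find_spec (hex y)⟩

/-- The distance to the common law of an identically distributed sample is at most the expected
distance to the empirical measure, because the robust distance is convex. -/
theorem robustW_le_expectedRobustW {lam : ℝ} (hlam : 0 ≤ lam) (ν μ : Measure X)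
    [IsProbabilityMeasure ν] [IsProbabilityMeasure μ] {m : ℕ} (hm : 1 ≤ m)
    (P : Measure (Fin m → X)) [IsProbabilityMeasure P] (hP : ∀ i, P.map (fun z => z i) = μ) :
    robustW lam ν μ ≤ expectedRobustW lam ν P := by
  refine le_of_forall_pos_le_add fun ε hε => ?_
  have : Nonempty (Fin m → X) := nonempty_of_isProbabilityMeasure P
  -- One third pays for near-optimality of `π k`, and one each for going from `z` to `d (j z)` in
  -- `κ` and back in `η`.
  have hε3 : 0 < ε / 3 := by positivity
  obtain ⟨j, hj, hjd⟩ := exists_measurable_nat_dist_lt (Fin m → X) hε3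
  set d := TopologicalSpace.denseSeq (Fin m → X)
  have hprob : ∀ z : Fin m → X, IsProbabilityMeasure (empiricalMeasure z) :=
    isProbabilityMeasure_empiricalMeasure hm
  -- Only countably many couplings are chosen, so `z ↦ π (j z)` is measurable without a measurable
  -- selection theorem.
  choose π hπ hπlt using fun k : ℕ => exists_coupling_integral_lt lam ν (empiricalMeasure (d k)) hε3
  have hπprob : ∀ k, IsProbabilityMeasure (π k) := fun k =>
    isProbabilityMeasure_of_mem_couplings (hπ k)
  have hdj : Measurable fun z => d (j z) := measurable_from_nat.comp hj
  have hpair : Measurable fun (z : Fin m → X) (i : Fin m) => (d (j z) i, z i) :=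
    measurable_pi_iff.2 fun i => ((measurable_pi_apply i).comp hdj).prodMk (measurable_pi_apply i)
  let κ : Kernel (Fin m → X) (X × X) := ⟨fun z => π (j z), measurable_from_nat.comp hj⟩
  let η : Kernel (Fin m → X) (X × X) :=
    ⟨fun z => empiricalMeasure fun i => (d (j z) i, z i),
      (measurable_empiricalMeasure m).comp hpair⟩
  have hκz : ∀ z, κ z = π (j z) := fun z => rfl
  have hηz : ∀ z, η z = empiricalMeasure fun i => (d (j z) i, z i) := fun z => rfl
  have : IsMarkovKernel κ := ⟨fun z => hπprob _⟩
  have : IsMarkovKernel η := ⟨fun z => isProbabilityMeasure_empiricalMeasure hm _⟩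
  have hκfst : κ.fst = Kernel.const _ ν := by
    ext1 z
    rw [Kernel.fst_apply, Kernel.const_apply, hκz]
    exact (hπ (j z)).1
  have hκη : κ.snd = η.fst := by
    ext1 z
    rw [Kernel.fst_apply, Kernel.snd_apply, hκz, hηz, map_empiricalMeasure _ measurable_fst]
    exact (hπ (j z)).2
  have hηsnd : η.snd = empiricalKernel X m := by
    ext1 z
    rw [Kernel.snd_apply, hηz, map_empiricalMeasure _ measurable_snd]
    rfl
  clear_value κ η
  have h₁ := robustW_kernel_comp_le hlam P κ
  have h₂ := robustW_kernel_comp_le hlam P η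
  rw [hκfst, hκη, Measure.const_comp, measure_univ, one_smul] at h₁
  rw [hηsnd, empiricalKernel_comp hm P μ hP] at h₂
  -- The intermediate measure is the mean empirical measure of the discretized sample: `κ` couples
  -- `ν` to it, and `η` couples it to `μ`.
  have h₃ := robustW_triangle hlam ν (η.fst ∘ₘ P) μ
  have hη : ∫ z, ∫ p, trimmedCost lam p.1 p.2 ∂η z ∂P ≤ ε / 3 := by
    refine (integral_mono_of_nonneg (ae_of_all _ fun z => integral_nonneg fun p =>
      trimmedCost_nonneg hlam _ _) (integrable_const (ε / 3)) (ae_of_all _ fun z => ?_)).trans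
      (by simp)
    simp only [hηz]
    refine (integral_trimmedCost_empiricalMeasure_le hlam hm (d (j z)) z).trans ?_
    rw [dist_comm]
    exact (hjd z).le
  have hκ : ∫ z, ∫ p, trimmedCost lam p.1 p.2 ∂κ z ∂P ≤
      expectedRobustW lam ν P + (ε / 3 + ε / 3) := by
    have hint := integrable_robustW_empiricalMeasure hlam ν hm P
    refine (integral_mono_of_nonneg (ae_of_all _ fun z => integral_nonneg fun p =>
      trimmedCost_nonneg hlam _ _) (hint.add (integrable_const (ε / 3 + ε / 3)))
      (ae_of_all _ fun z => ?_)).trans ?_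
    · have h4 := robustW_triangle hlam ν (empiricalMeasure z) (empiricalMeasure (d (j z)))
      have h5 := robustW_empiricalMeasure_le_dist hlam hm z (d (j z))
      have h6 := hπlt (j z)
      rw [← hκz] at h6
      have h7 := hjd z
      simp only [Pi.add_apply]
      linarith
    · rw [integral_add' hint (integrable_const _)]
      simp [expectedRobustW]
  linarith

end Expected

theorem theorem10
    -- the sample space, a Polish space with a compatible metric
    {X : Type*} [MetricSpace X] [PolishSpace X] [MeasurableSpace X] [BorelSpace X]
    -- the parameter space with its distance; bounded closed sets of parameters are compact
    {Θ : Type*} [MetricSpace Θ] [ProperSpace Θ] [Nonempty Θ]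
    (lam : ℝ) (hlam : 0 < lam)
    -- the data, which are fixed
    {n : ℕ} (hn : 1 ≤ n) (x : Fin n → X)
    -- the model: the distributions `μ_θ`, and the joint laws `μ_θ^(m)` of samples of size `m`
    (μ : Θ → ProbabilityMeasure X)
    (μs : Θ → (m : ℕ) → ProbabilityMeasure (Fin m → X))
    -- the observations of the model are identically distributed: each one has the law `μ_θ`
    (hid : ∀ (θ : Θ) (m : ℕ) (i : Fin m),
      (μs θ m : Measure (Fin m → X)).map (fun z => z i) = (μ θ : Measure X))
    -- `θ ↦ μ_θ` is weakly continuous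
    (h2 : ∀ (t : ℕ → Θ) (θ : Θ), Tendsto t atTop (𝓝 θ) →
      Tendsto (fun k => μ (t k)) atTop (𝓝 (μ θ)))
    -- `θ ↦ μ_θ^(m)` is weakly continuous for every `m ≥ 1`
    (h4 : ∀ m : ℕ, 1 ≤ m → ∀ (t : ℕ → Θ) (θ : Θ), Tendsto t atTop (𝓝 θ) →
      Tendsto (fun k => μs (t k) m) atTop (𝓝 (μs θ m)))
    -- along convergent parameters the empirical measures of the model approach the model
    (h5 : ∀ (t : ℕ → Θ) (θ : Θ), Tendsto t atTop (𝓝 θ) →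
      Tendsto (fun k => expectedRobustW lam (μ (t k) : Measure X)
        (μs (t k) k : Measure (Fin k → X))) atTop (𝓝 0))
    -- some set of near-minimizers is bounded
    (h6 : ∃ ε : ℝ, 0 < ε ∧ Bornology.IsBounded
      {θ : Θ | robustW lam (empiricalMeasure x) (μ θ : Measure X) ≤
        (⨅ θ' : Θ, robustW lam (empiricalMeasure x) (μ θ' : Measure X)) + ε}) :
    Tendsto
      (fun m : ℕ => ⨅ θ : Θ, expectedRobustW lam (empiricalMeasure x)
        (μs θ m : Measure (Fin m → X)))
      atTop (𝓝 (⨅ θ : Θ, robustW lam (empiricalMeasure x) (μ θ : Measure X))) ∧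
    (∃ m₀ : ℕ,
      (∀ m : ℕ, m₀ ≤ m →
        (argminSet fun θ : Θ => expectedRobustW lam (empiricalMeasure x)
          (μs θ m : Measure (Fin m → X))).Nonempty) ∧
      Bornology.IsBounded (⋃ m : ℕ, ⋃ _ : m₀ ≤ m,
        argminSet fun θ : Θ => expectedRobustW lam (empiricalMeasure x)
          (μs θ m : Measure (Fin m → X)))) ∧
    outerLimit
        (fun m : ℕ => argminSet fun θ : Θ => expectedRobustW lam (empiricalMeasure x)
          (μs θ m : Measure (Fin m → X))) ⊆
      argminSet fun θ : Θ => robustW lam (empiricalMeasure x) (μ θ : Measure X) := by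
  have hν : IsProbabilityMeasure (empiricalMeasure x) := isProbabilityMeasure_empiricalMeasure hn x
  refine tendsto_iInf_and_outerLimit_argminSet
    ⟨0, by rintro _ ⟨θ, rfl⟩; exact robustW_nonneg hlam.le _ _⟩ (fun m hm => ?_)
    (fun m hm θ => robustW_le_expectedRobustW hlam.le _ _ hm _ (hid θ m)) (fun t θ ht => ?_) h6
  · refine continuous_iff_seqContinuous.2 fun t θ ht => ?_
    exact ((continuous_expectedRobustW hlam.le (empiricalMeasure x) hm).tendsto _).comp
      (h4 m hm t θ ht)
  · refine squeeze_zero_norm' ?_ (h5 t θ ht)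
    filter_upwards [eventually_ge_atTop 1] with k hk
    exact abs_expectedRobustW_sub_le hlam.le _ _ hk _
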